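/- \textbf{Setting.} Let $G=(V,E)$ be a finite simple graph with at least one edge, with maximum degree $\Delta\ge 1$, and let $S$ be a finite set of spins. To each edge $\{v,w\}$ let a weight function $\alpha_{vw}:S\times S\to[0,\infty)$ be attached, with $\alpha_{vw}(a,b)=\alpha_{wv}(b,a)$. Assume that some configuration $\sigma\in S^V$ has positive weight $\prod_{\{v,w\}\in E}\alpha_{vw}(\sigma_v,\sigma_w)$, and let $\mu$ be the Gibbs distribution, the probability measure on $S^V$ proportional to this weight. Write $\mu(f)=\int f\,d\mu$ and $\|f\|_2=\mu(f^2)^{1/2}$. The heat-bath Glauber dynamics is the continuous-time Markov chain on $\{\sigma:\mu[\sigma]>0\}$ with generator $$(\mathcal L f)(\sigma)=\sum_{v\in V}\sum_{a\in S}K[\sigma\to\sigma_v^a]\bigl(f(\sigma_v^a)-f(\sigma)\bigr),\qquad K[\sigma\to\sigma_v^a]=\frac{\prod_{w\sim v}\alpha_{vw}(a,\sigma_w)}{\sum_{a'\in S}\prod_{w\sim v}\alpha_{vw}(a',\sigma_w)},$$ where $\sigma_v^a$ is $\sigma$ with the spin at $v$ replaced by $a$. Let $0=\lambda_1\le\lambda_2\le\cdots$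 be the eigenvalues of $-\mathcal L$, with multiplicity; $\lambda_2$ is the spectral gap. (If only one configuration has positive probability, put $\lambda_2=0$.) For $0<c\le 1$ let $I(c)=c-\log c-1$. For $A\subseteq V$ let $\partial_iA$ be the set of vertices of $A$ that have a neighbour outside $A$. \textbf{Proposition.} There is a unique $c^*\in(0,1]$ with $I(c^*)=\log\Delta$ (so $c^*\in(0,1)$ if $\Delta\ge2$, and $c^*=1$ if $\Delta=1$). For $0<c<c^*$ put $C(c,\Delta)=\bigl(1-e^{\log\Delta-I(c)}\bigr)^{-1/2}$. Let $A,B\subseteq V$, and let $d=\operatorname{dist}(A,B)$ be their graph distance if it is finite; more generally, let $d\ge0$ be any integer with $d\le\operatorname{dist}(A,B)$ (thus any integer $d\ge 0$ if no path joins $A$ to $B$). Let $f,g:S^V\to\mathbb R$ be such that $f(\sigma)$ depends only on the spins in $A$, $g(\sigma)$ depends only on the spins in $B$, and $\mu(f)=\mu(g)=0$. Then for every $0<c<c^*$ $$\mu(fg)\le\Bigl(e^{-cd\lambda_2}+2C(c,\Delta)\sqrt{|\partial_iA|\,e^{d(\log\Delta-I(c))}}\Bigr)\|f\|_2\|g\|_2,$$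 and for every $\gamma\ge0$ $$\mu(fg)\le\Bigl(e^{-d\lambda_2\exp(-\log\Delta-\gamma-2)}+4\sqrt{e^{-(\gamma+1)d}\,|\partial_iA|}\Bigr)\|f\|_2\|g\|_2.$$ -/

import Mathlib

namespace Glauber

/-- A system of pair weights `α_{vw} : S × S → [0, ∞)` for spins in `S` at sites in `V`. Weights
belong to unordered pairs `{v, w}`, whence the symmetry. Only pairs that are edges of the
underlying graph are ever used, so the values at other pairs are irrelevant. -/
structure PairWeights (V S : Type*) where
  /-- `α v w a b` is the weight of the pair `{v, w}` when `v` has spin `a` and `w` has spin `b`. -/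
  α : V → V → S → S → ℝ
  nonneg : ∀ v w a b, 0 ≤ α v w a b
  symm : ∀ v w a b, α v w a b = α w v b a

section Model

variable {V S : Type*} [Fintype V] [DecidableEq V] [Fintype S]
variable (P : PairWeights V S) (G : SimpleGraph V) [DecidableRel G.Adj]

/-- The factor `α_{vw}(σ_v, σ_w)` of an unordered pair `{v, w}`. -/
def pairFactor {V S : Type*} (P : PairWeights V S) (σ : V → S) : Sym2 V → ℝ :=
  Sym2.lift ⟨fun v w => P.α v w (σ v) (σ w), fun v w => P.symm v w (σ v) (σ w)⟩

/-- The weight `∏_{ {v,w} ∈ E } α_{vw}(σ_v, σ_w)` of a configuration. -/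
def weight (σ : V → S) : ℝ := ∏ e ∈ G.edgeFinset, pairFactor P σ e

/-- The normalizing constant of the Gibbs distribution. -/
def partitionFunction : ℝ := ∑ σ : V → S, weight P G σ

/-- The Gibbs probability `μ[σ]`. -/
noncomputable def gibbsProb (σ : V → S) : ℝ := weight P G σ / partitionFunction P G

/-- The Gibbs expectation `μ(f)`. -/
noncomputable def gibbsMean (f : (V → S) → ℝ) : ℝ := ∑ σ : V → S, gibbsProb P G σ * f σ

/-- The norm `‖f‖₂` of `L²(μ)`. -/
noncomputable def l2Norm (f : (V → S) → ℝ) : ℝ := Real.sqrt (gibbsMean P G fun σ => f σ ^ 2)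

/-- The product `∏_{w ∼ v} α_{vw}(a, σ_w)`. -/
def localWeight (σ : V → S) (v : V) (a : S) : ℝ := ∏ w ∈ G.neighborFinset v, P.α v w a (σ w)

/-- The heat-bath rate `K[σ → σ_v^a]`, at which the spin at `v` is updated to `a`. -/
noncomputable def heatBathRate (σ : V → S) (v : V) (a : S) : ℝ :=
  localWeight P G σ v a / ∑ a' : S, localWeight P G σ v a'

/-- The state space of the dynamics: the configurations of positive Gibbs probability. -/
abbrev Feasible : Type _ := {σ : V → S // 0 < weight P G σ}

/-- Extension by zero of a function on the state space. -/
noncomputable def extendZero (f : Feasible P G → ℝ) (σ : V → S) : ℝ :=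
  open Classical in if h : 0 < weight P G σ then f ⟨σ, h⟩ else 0

/-- The generator of the heat-bath Glauber dynamics,
`(L f)(σ) = ∑_v ∑_a K[σ → σ_v^a] (f(σ_v^a) - f(σ))`.
From a configuration of positive probability the rate to a configuration of probability zero is
zero, so the value that `extendZero` gives to `f` there plays no role. -/
noncomputable def generator : (Feasible P G → ℝ) →ₗ[ℝ] (Feasible P G → ℝ) where
  toFun f σ := ∑ v : V, ∑ a : S,
    heatBathRate P G σ.1 v a * (extendZero P G f (Function.update σ.1 v a) - f σ)
  map_add' f g := by
    funext σ
    refine (Finset.sum_congr rfl fun v _ => ?_).trans Finset.sum_add_distrib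
    refine (Finset.sum_congr rfl fun a _ => ?_).trans Finset.sum_add_distrib
    unfold extendZero
    simp only [Pi.add_apply]
    split_ifs <;> ring
  map_smul' r f := by
    funext σ
    simp only [Pi.smul_apply, smul_eq_mul, RingHom.id_apply, Finset.mul_sum]
    refine Finset.sum_congr rfl fun v _ => Finset.sum_congr rfl fun a _ => ?_
    unfold extendZero
    simp only [Pi.smul_apply, smul_eq_mul]
    split_ifs <;> ring

/-- The spectral gap `λ₂`: the absolute value of the second entry in the list of the eigenvalues
`0 = -λ₁ ≥ -λ₂ ≥ …` of the generator, in decreasing order and repeated according to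
multiplicity. (If there is only one state there is no second eigenvalue; the value is then `0`,
and the only function of mean zero is zero.) -/
noncomputable def spectralGap : ℝ :=
  |((generator P G).charpoly.roots.sort (· ≥ ·)).getD 1 0|

end Model

/-- The graph distance between two sets of vertices, `⊤` if no path joins them. -/
noncomputable def setDist {V : Type*} (G : SimpleGraph V) (A B : Finset V) : ℕ∞ :=
  ⨅ a ∈ A, ⨅ b ∈ B, G.edist a b

/-- The inner boundary `∂ᵢ A`: the vertices of `A` with a neighbour outside `A`. -/
def innerBoundary {V : Type*} [Fintype V] [DecidableEq V] (G : SimpleGraph V)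
    [DecidableRel G.Adj] (A : Finset V) : Finset V :=
  A.filter fun v => ∃ u, u ∉ A ∧ G.Adj v u

/-- The rate function `I(c) = c - log c - 1`. -/
noncomputable def rateI (c : ℝ) : ℝ := c - Real.log c - 1

/-- The constant `C(c, Δ) = (1 - e^{log Δ - I(c)})^{-1/2}`. -/
noncomputable def constC (c : ℝ) (Δ : ℕ) : ℝ :=
  (1 - Real.exp (Real.log Δ - rateI c)) ^ (-(1 / 2) : ℝ)

/-- `c` is the critical value `c*` for maximum degree `Δ`, i.e. the solution of `I(c) = log Δ` in
`(0, 1]`. As `I(1) = 0`, it lies in `(0, 1)` if `Δ ≥ 2`, and is `1` if `Δ = 1`. -/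
def IsCritical (Δ : ℕ) (c : ℝ) : Prop := 0 < c ∧ c ≤ 1 ∧ rateI c = Real.log Δ

end Glauber

/-! Each heat-bath operator `E_v` is an orthogonal projection in `L²(μ)`, and the discrete-time
chain `M = |V|⁻¹ ∑_v E_v` equals `I + |V|⁻¹ L` on the state space. The covariance `⟨g, f⟩` is
compared with `⟨g, M^k f⟩` for every `k`, and the comparisons are then averaged over a Poisson
number of steps.

Decay in time: `-L` has spectrum in `[0, |V|]`, so `M` contracts mean-zero functions by the factor
`1 - λ₂/|V|` (`l2Norm_meanHeatBath_le`).

Finite speed: `M^k` is the mean of `E_{w_k} ⋯ E_{w_1}` over random words `w`. If no walk from `A` to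
`B` is a subword of `w`, the updates in `B` can be suppressed (`wordOp_heatBath_eq`). The other
operators are self-adjoint and fix `g`, so the covariance with `g` stays `⟨g, f⟩`. Any other word
costs at most `2‖f‖₂‖g‖₂` and contains one of the at most `|∂ᵢA| Δ^d` walks of length `d` starting
in `∂ᵢA`. A Chernoff bound for the occurrence of a fixed subword (`wordMean_subwordIndicator_le`)
and a union bound give `gibbsInner_le_add`.

Poisson averaging at time `cd`, with Chernoff parameter `c`, bounds the error by `2q‖f‖₂‖g‖₂`, where
`q = |∂ᵢA| e^{d(log Δ - I(c))}`. If `q ≤ 1` then `q ≤ √q`; if `q ≥ 1`, Cauchy-Schwarz is enough.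
This gives `gibbsMean_mul_le`, from which both inequalities follow: the first because `C(c, Δ) ≥ 1`,
the second by a choice of `c`. -/

namespace Glauber

/-! ### Heat-bath operators as local orthogonal projections in `L²(μ)` -/

section HeatBath

variable {V S : Type*} [Fintype V] [DecidableEq V] [Fintype S]
variable (P : PairWeights V S) (G : SimpleGraph V) [DecidableRel G.Adj]

set_option linter.unusedSectionVars false

lemma pairFactor_nonneg (σ : V → S) (e : Sym2 V) : 0 ≤ pairFactor P σ e := by
  induction e with
  | _ v w => exact P.nonneg v w _ _

lemma weight_nonneg (σ : V → S) : 0 ≤ weight P G σ :=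
  Finset.prod_nonneg fun e _ => pairFactor_nonneg P σ e

lemma localWeight_nonneg (σ : V → S) (v : V) (a : S) : 0 ≤ localWeight P G σ v a :=
  Finset.prod_nonneg fun w _ => P.nonneg v w _ _

/-- The normalizing constant of the heat-bath rates at a site. -/
def localSum (σ : V → S) (v : V) : ℝ := ∑ a : S, localWeight P G σ v a

lemma localWeight_congr {σ τ : V → S} {v : V} (h : ∀ w, G.Adj v w → σ w = τ w) (a : S) :
    localWeight P G σ v a = localWeight P G τ v a :=
  Finset.prod_congr rfl fun w hw => by
    rw [h w ((G.mem_neighborFinset v w).1 hw)]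

lemma localSum_congr {σ τ : V → S} {v : V} (h : ∀ w, G.Adj v w → σ w = τ w) :
    localSum P G σ v = localSum P G τ v :=
  Finset.sum_congr rfl fun a _ => localWeight_congr P G h a

lemma heatBathRate_congr {σ τ : V → S} {v : V} (h : ∀ w, G.Adj v w → σ w = τ w) (a : S) :
    heatBathRate P G σ v a = heatBathRate P G τ v a := by
  unfold heatBathRate
  rw [localWeight_congr P G h a]
  exact congrArg _ (localSum_congr P G h)

lemma update_eq_of_adj (σ : V → S) {v : V} (a : S) (w : V) (h : G.Adj v w) :
    Function.update σ v a w = σ w :=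
  Function.update_of_ne h.ne' a σ

lemma localWeight_update (σ : V → S) (v : V) (a b : S) :
    localWeight P G (Function.update σ v b) v a = localWeight P G σ v a :=
  localWeight_congr P G (update_eq_of_adj G σ b) a

lemma localSum_update (σ : V → S) (v : V) (b : S) :
    localSum P G (Function.update σ v b) v = localSum P G σ v :=
  localSum_congr P G (update_eq_of_adj G σ b)

lemma heatBathRate_update (σ : V → S) (v : V) (a b : S) :
    heatBathRate P G (Function.update σ v b) v a = heatBathRate P G σ v a :=
  heatBathRate_congr P G (update_eq_of_adj G σ b) a

lemma sum_heatBathRate {σ : V → S} {v : V} (h : localSum P G σ v ≠ 0) :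
    ∑ a : S, heatBathRate P G σ v a = 1 := by
  simp only [heatBathRate, ← Finset.sum_div]
  exact div_self h

/-- The part of the weight of a configuration that does not involve the site `v`. -/
def restWeight (σ : V → S) (v : V) : ℝ :=
  ∏ e ∈ G.edgeFinset with v ∉ e, pairFactor P σ e

lemma restWeight_update (σ : V → S) (v : V) (a : S) :
    restWeight P G (Function.update σ v a) v = restWeight P G σ v := by
  refine Finset.prod_congr rfl fun e he => ?_
  have hv := (Finset.mem_filter.1 he).2
  induction e with
  | _ x y =>
    rw [Sym2.mem_iff, not_or] at hv
    simp only [pairFactor, Sym2.lift_mk]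
    rw [Function.update_of_ne (Ne.symm hv.1), Function.update_of_ne (Ne.symm hv.2)]

lemma weight_eq (σ : V → S) (v : V) :
    weight P G σ = restWeight P G σ v * localWeight P G σ v (σ v) := by
  have himg : G.edgeFinset.filter (fun e => v ∈ e) =
      (G.neighborFinset v).image fun w => s(v, w) := by
    ext e
    induction e with
    | _ x y =>
      simp only [Finset.mem_filter, SimpleGraph.mem_edgeFinset, SimpleGraph.mem_edgeSet,
        Finset.mem_image, SimpleGraph.mem_neighborFinset, Sym2.mem_iff]
      constructor
      · rintro ⟨h, rfl | rfl⟩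
        · exact ⟨y, h, rfl⟩
        · exact ⟨x, h.symm, Sym2.eq_swap⟩
      · rintro ⟨w, hw, h⟩
        rcases Sym2.eq_iff.1 h with ⟨rfl, rfl⟩ | ⟨rfl, rfl⟩
        · exact ⟨hw, Or.inl rfl⟩
        · exact ⟨hw.symm, Or.inr rfl⟩
  have hloc : ∏ e ∈ G.edgeFinset with v ∈ e, pairFactor P σ e = localWeight P G σ v (σ v) := by
    rw [himg, Finset.prod_image]
    · rfl
    · intro w _ w' _ h
      exact Sym2.congr_right.1 h
  rw [← hloc, mul_comm]
  exact (Finset.prod_filter_mul_prod_filter_not _ _ _).symm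

lemma weight_update (σ : V → S) (v : V) (a : S) :
    weight P G (Function.update σ v a) = restWeight P G σ v * localWeight P G σ v a := by
  rw [weight_eq P G _ v, restWeight_update, localWeight_update, Function.update_self]

lemma weight_eq_zero_of_localSum {σ : V → S} {v : V} (h : localSum P G σ v = 0) :
    weight P G σ = 0 := by
  rw [weight_eq P G σ v, (Finset.sum_eq_zero_iff_of_nonneg
    fun a _ => localWeight_nonneg P G σ v a).1 h (σ v) (Finset.mem_univ _), mul_zero]

lemma heatBathRate_eq_zero {σ : V → S} {v : V} {a : S} (hσ : 0 < weight P G σ)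
    (ha : ¬ 0 < weight P G (Function.update σ v a)) : heatBathRate P G σ v a = 0 := by
  have h0 : weight P G (Function.update σ v a) = 0 := le_antisymm (not_lt.1 ha) (weight_nonneg P G _)
  rw [weight_update] at h0
  rw [weight_eq P G σ v] at hσ
  have : localWeight P G σ v a = 0 :=
    (mul_eq_zero.1 h0).resolve_left fun h => by simp [h] at hσ
  simp [heatBathRate, this]

lemma detailed_balance (σ : V → S) (v : V) (a : S) :
    weight P G (Function.update σ v a) * heatBathRate P G (Function.update σ v a) v (σ v) =
      weight P G σ * heatBathRate P G σ v a := by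
  rw [weight_update, heatBathRate_update, weight_eq P G σ v]
  unfold heatBathRate
  ring

/-- The heat-bath operator at `v`, which averages over the spin at `v` given the other spins (and
is the identity at the configurations where this conditional law is undefined). -/
noncomputable def heatBath (v : V) : ((V → S) → ℝ) →ₗ[ℝ] ((V → S) → ℝ) where
  toFun f σ := open Classical in if localSum P G σ v = 0 then f σ else
    ∑ a : S, heatBathRate P G σ v a * f (Function.update σ v a)
  map_add' f g := by
    funext σ
    simp only [Pi.add_apply]
    split_ifs
    · rfl
    · rw [← Finset.sum_add_distrib]
      exact Finset.sum_congr rfl fun a _ => mul_add _ _ _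
  map_smul' r f := by
    funext σ
    simp only [Pi.smul_apply, smul_eq_mul, RingHom.id_apply]
    split_ifs
    · rfl
    · rw [Finset.mul_sum]
      exact Finset.sum_congr rfl fun a _ => mul_left_comm _ _ _

lemma heatBath_of_eq_zero {σ : V → S} {v : V} (h : localSum P G σ v = 0) (f : (V → S) → ℝ) :
    heatBath P G v f σ = f σ := if_pos h

lemma heatBath_of_ne_zero {σ : V → S} {v : V} (h : localSum P G σ v ≠ 0) (f : (V → S) → ℝ) :
    heatBath P G v f σ = ∑ a : S, heatBathRate P G σ v a * f (Function.update σ v a) := if_neg h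

lemma heatBath_mul {A : Finset V} {v : V} (hv : v ∉ A) {g : (V → S) → ℝ}
    (hg : DependsOn g (A : Set V)) (f : (V → S) → ℝ) :
    heatBath P G v (fun σ => g σ * f σ) = fun σ => g σ * heatBath P G v f σ := by
  funext σ
  by_cases h : localSum P G σ v = 0
  · simp only [heatBath_of_eq_zero P G h]
  · simp only [heatBath_of_ne_zero P G h, Finset.mul_sum]
    refine Finset.sum_congr rfl fun a _ => ?_
    have : g (Function.update σ v a) = g σ := hg fun w hw =>
      Function.update_of_ne (by rintro rfl; exact hv hw) a σ
    rw [this, mul_left_comm]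

lemma heatBath_one (v : V) : heatBath P G v (fun _ => 1) = fun _ => 1 := by
  funext σ
  by_cases h : localSum P G σ v = 0
  · simp only [heatBath_of_eq_zero P G h]
  · simp only [heatBath_of_ne_zero P G h, mul_one, sum_heatBathRate P G h]

lemma heatBath_eq_self {A : Finset V} {v : V} (hv : v ∉ A) {f : (V → S) → ℝ}
    (hf : DependsOn f (A : Set V)) : heatBath P G v f = f := by
  simpa [heatBath_one] using heatBath_mul P G hv hf fun _ => 1

lemma dependsOn_heatBath {A : Finset V} {v : V} (hv : v ∈ A) {f : (V → S) → ℝ}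
    (hf : DependsOn f (A : Set V)) :
    DependsOn (heatBath P G v f) ((A ∪ G.neighborFinset v : Finset V) : Set V) := by
  intro σ τ h
  have hA : ∀ w ∈ A, σ w = τ w := fun w hw => h w (by simp [hw])
  have hN : ∀ w, G.Adj v w → σ w = τ w := fun w hw => h w (by simp [hw])
  by_cases h0 : localSum P G σ v = 0
  · rw [heatBath_of_eq_zero P G h0, heatBath_of_eq_zero P G (by rwa [← localSum_congr P G hN])]
    exact hf hA
  · rw [heatBath_of_ne_zero P G h0, heatBath_of_ne_zero P G (by rwa [← localSum_congr P G hN])]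
    refine Finset.sum_congr rfl fun a _ => ?_
    rw [heatBathRate_congr P G hN]
    congr 1
    refine hf fun w hw => ?_
    by_cases hwv : w = v
    · subst hwv; simp
    · rw [Function.update_of_ne hwv, Function.update_of_ne hwv, hA w hw]

lemma heatBath_idem (v : V) (f : (V → S) → ℝ) :
    heatBath P G v (heatBath P G v f) = heatBath P G v f := by
  funext σ
  by_cases h : localSum P G σ v = 0
  · rw [heatBath_of_eq_zero P G h]
  · rw [heatBath_of_ne_zero P G h]
    have : ∀ a, heatBath P G v f (Function.update σ v a) = heatBath P G v f σ := fun a => by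
      rw [heatBath_of_ne_zero P G h, heatBath_of_ne_zero P G (by rwa [localSum_update])]
      simp only [heatBathRate_update, Function.update_idem]
    simp only [this, ← Finset.sum_mul, sum_heatBathRate P G h, one_mul]

/-- The inner product of `L²(μ)`. -/
noncomputable def gibbsInner (f g : (V → S) → ℝ) : ℝ := gibbsMean P G fun σ => f σ * g σ

lemma gibbsProb_nonneg (σ : V → S) : 0 ≤ gibbsProb P G σ :=
  div_nonneg (weight_nonneg P G σ) (Finset.sum_nonneg fun σ _ => weight_nonneg P G σ)

lemma gibbsInner_comm (f g : (V → S) → ℝ) : gibbsInner P G f g = gibbsInner P G g f := by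
  simp only [gibbsInner, mul_comm]

lemma gibbsInner_add_right (f g h : (V → S) → ℝ) :
    gibbsInner P G f (g + h) = gibbsInner P G f g + gibbsInner P G f h := by
  simp only [gibbsInner, gibbsMean, Pi.add_apply, ← Finset.sum_add_distrib]
  exact Finset.sum_congr rfl fun σ _ => by ring

lemma gibbsInner_smul_right (f g : (V → S) → ℝ) (r : ℝ) :
    gibbsInner P G f (r • g) = r * gibbsInner P G f g := by
  simp only [gibbsInner, gibbsMean, Pi.smul_apply, smul_eq_mul, Finset.mul_sum]
  exact Finset.sum_congr rfl fun σ _ => by ring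

lemma gibbsInner_sum_right {ι : Type*} (s : Finset ι) (f : (V → S) → ℝ) (g : ι → (V → S) → ℝ) :
    gibbsInner P G f (∑ i ∈ s, g i) = ∑ i ∈ s, gibbsInner P G f (g i) := by
  classical
  induction s using Finset.induction_on with
  | empty => simp [gibbsInner, gibbsMean]
  | insert i s hi ih => rw [Finset.sum_insert hi, Finset.sum_insert hi, gibbsInner_add_right, ih]

lemma gibbsInner_sub_right (f g h : (V → S) → ℝ) :
    gibbsInner P G f (g - h) = gibbsInner P G f g - gibbsInner P G f h := by
  rw [sub_eq_add_neg, gibbsInner_add_right, ← neg_one_smul ℝ h, gibbsInner_smul_right]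
  ring

lemma gibbsInner_sub_left (f g h : (V → S) → ℝ) :
    gibbsInner P G (f - g) h = gibbsInner P G f h - gibbsInner P G g h := by
  rw [gibbsInner_comm, gibbsInner_sub_right, gibbsInner_comm P G h f, gibbsInner_comm P G h g]

lemma gibbsInner_self_nonneg (f : (V → S) → ℝ) : 0 ≤ gibbsInner P G f f :=
  Finset.sum_nonneg fun σ _ => mul_nonneg (gibbsProb_nonneg P G σ) (mul_self_nonneg _)

lemma l2Norm_eq (f : (V → S) → ℝ) : l2Norm P G f = √(gibbsInner P G f f) := by
  simp only [l2Norm, gibbsInner, sq]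

lemma l2Norm_nonneg (f : (V → S) → ℝ) : 0 ≤ l2Norm P G f := Real.sqrt_nonneg _

lemma gibbsInner_le (f g : (V → S) → ℝ) :
    gibbsInner P G f g ≤ l2Norm P G f * l2Norm P G g := by
  have h := Real.sum_mul_le_sqrt_mul_sqrt Finset.univ (fun σ => √(gibbsProb P G σ) * f σ)
    (fun σ => √(gibbsProb P G σ) * g σ)
  have key : ∀ f g : (V → S) → ℝ, ∑ σ, (√(gibbsProb P G σ) * f σ) * (√(gibbsProb P G σ) * g σ) =
      gibbsInner P G f g := fun f g => Finset.sum_congr rfl fun σ _ => by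
    rw [mul_mul_mul_comm, Real.mul_self_sqrt (gibbsProb_nonneg P G σ)]
  simp only [sq, key] at h
  rwa [l2Norm_eq, l2Norm_eq]

/-- Reversibility: written as a sum over pairs (configuration, new spin), the form is symmetric by
detailed balance. -/
lemma gibbsInner_heatBath (v : V) (f g : (V → S) → ℝ) :
    gibbsInner P G g (heatBath P G v f) = gibbsInner P G (heatBath P G v g) f := by
  have key : ∀ f g : (V → S) → ℝ, gibbsInner P G g (heatBath P G v f) =
      (∑ p : (V → S) × S, weight P G p.1 * heatBathRate P G p.1 v p.2 * g p.1 *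
        f (Function.update p.1 v p.2)) / partitionFunction P G := fun f g => by
    simp only [gibbsInner, gibbsMean, gibbsProb]
    rw [Fintype.sum_prod_type, Finset.sum_div]
    refine Finset.sum_congr rfl fun σ _ => ?_
    by_cases h : localSum P G σ v = 0
    · simp [weight_eq_zero_of_localSum P G h]
    · rw [heatBath_of_ne_zero P G h, Finset.mul_sum, Finset.mul_sum, Finset.sum_div]
      exact Finset.sum_congr rfl fun a _ => by ring
  rw [gibbsInner_comm P G (heatBath P G v g) f, key, key]
  congr 1
  -- The involution runs an update backwards, exchanging the old and the new spin at `v`.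
  let φ : (V → S) × S → (V → S) × S := fun p => (Function.update p.1 v p.2, p.1 v)
  have hφ : Function.Involutive φ := fun p => by simp [φ]
  rw [← Equiv.sum_comp hφ.toPerm]
  refine Finset.sum_congr rfl fun p _ => ?_
  simp only [Function.Involutive.coe_toPerm, φ, detailed_balance, Function.update_idem,
    Function.update_eq_self]
  ring

lemma gibbsInner_heatBath_self (v : V) (f : (V → S) → ℝ) :
    gibbsInner P G f (heatBath P G v f) =
      gibbsInner P G (heatBath P G v f) (heatBath P G v f) := by
  rw [← gibbsInner_heatBath, heatBath_idem]

lemma gibbsInner_heatBath_nonneg (v : V) (f : (V → S) → ℝ) :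
    0 ≤ gibbsInner P G f (heatBath P G v f) := by
  rw [gibbsInner_heatBath_self]
  exact gibbsInner_self_nonneg P G _

lemma gibbsInner_heatBath_le (v : V) (f : (V → S) → ℝ) :
    gibbsInner P G f (heatBath P G v f) ≤ gibbsInner P G f f := by
  have h := gibbsInner_self_nonneg P G (f - heatBath P G v f)
  rw [gibbsInner_sub_right, gibbsInner_sub_left, gibbsInner_sub_left,
    ← gibbsInner_heatBath_self, gibbsInner_comm P G (heatBath P G v f) f] at h
  linarith

lemma l2Norm_heatBath_le (v : V) (f : (V → S) → ℝ) :
    l2Norm P G (heatBath P G v f) ≤ l2Norm P G f := by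
  rw [l2Norm_eq, l2Norm_eq, ← gibbsInner_heatBath_self]
  exact Real.sqrt_le_sqrt (gibbsInner_heatBath_le P G v f)

lemma gibbsMean_eq_inner (f : (V → S) → ℝ) : gibbsMean P G f = gibbsInner P G (fun _ => 1) f := by
  simp [gibbsInner]

lemma gibbsMean_heatBath (v : V) (f : (V → S) → ℝ) :
    gibbsMean P G (heatBath P G v f) = gibbsMean P G f := by
  rw [gibbsMean_eq_inner, gibbsMean_eq_inner, gibbsInner_heatBath, heatBath_one]

lemma gibbsInner_heatBath_of_notMem {B : Finset V} {v : V} (hv : v ∉ B) {g : (V → S) → ℝ}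
    (hg : DependsOn g (B : Set V)) (f : (V → S) → ℝ) :
    gibbsInner P G g (heatBath P G v f) = gibbsInner P G g f := by
  rw [gibbsInner_heatBath, heatBath_eq_self P G hv hg]

/-- The average `|V|⁻¹ ∑_v E_v` of the heat-bath operators. -/
noncomputable def meanHeatBath : ((V → S) → ℝ) →ₗ[ℝ] ((V → S) → ℝ) :=
  (Fintype.card V : ℝ)⁻¹ • ∑ v, heatBath P G v

lemma meanHeatBath_apply (f : (V → S) → ℝ) :
    meanHeatBath P G f = (Fintype.card V : ℝ)⁻¹ • ∑ v, heatBath P G v f := by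
  simp [meanHeatBath]

lemma gibbsMean_meanHeatBath [Nonempty V] (f : (V → S) → ℝ) :
    gibbsMean P G (meanHeatBath P G f) = gibbsMean P G f := by
  rw [gibbsMean_eq_inner, meanHeatBath_apply, gibbsInner_smul_right, gibbsInner_sum_right]
  simp only [← gibbsMean_eq_inner, gibbsMean_heatBath, Finset.sum_const, Finset.card_univ,
    nsmul_eq_mul]
  rw [inv_mul_cancel_left₀ (by simp)]

end HeatBath

/-! ### Random words and the occurrence of subwords -/

section Words

variable {V : Type*} [Fintype V]

/-- The average of `F` over the words of length `k` in the alphabet `V`. -/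
noncomputable def wordMean : ℕ → (List V → ℝ) → ℝ
  | 0, F => F []
  | k + 1, F => (Fintype.card V : ℝ)⁻¹ * ∑ v, wordMean k fun w => F (v :: w)

lemma wordMean_mono (k : ℕ) {F F' : List V → ℝ} (h : ∀ w, F w ≤ F' w) :
    wordMean k F ≤ wordMean k F' := by
  induction k generalizing F F' with
  | zero => exact h []
  | succ k ih =>
    exact mul_le_mul_of_nonneg_left (Finset.sum_le_sum fun v _ => ih fun w => h (v :: w))
      (by positivity)

lemma wordMean_const [Nonempty V] (k : ℕ) (r : ℝ) : wordMean k (fun _ : List V => r) = r := by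
  induction k with
  | zero => rfl
  | succ k ih =>
    simp only [wordMean, ih, Finset.sum_const, Finset.card_univ, nsmul_eq_mul]
    rw [inv_mul_cancel_left₀ (by simp)]

lemma wordMean_add (k : ℕ) (F F' : List V → ℝ) :
    wordMean k (fun w => F w + F' w) = wordMean k F + wordMean k F' := by
  induction k generalizing F F' with
  | zero => rfl
  | succ k ih => simp only [wordMean, ih, Finset.sum_add_distrib, mul_add]

lemma wordMean_const_mul (k : ℕ) (r : ℝ) (F : List V → ℝ) :
    wordMean k (fun w => r * F w) = r * wordMean k F := by
  induction k generalizing F with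
  | zero => rfl
  | succ k ih =>
    simp only [wordMean, ih, ← Finset.mul_sum]
    ring

lemma wordMean_sum [Nonempty V] {ι : Type*} (s : Finset ι) (k : ℕ) (F : ι → List V → ℝ) :
    wordMean k (fun w => ∑ i ∈ s, F i w) = ∑ i ∈ s, wordMean k (F i) := by
  classical
  induction s using Finset.induction_on with
  | empty => simp [wordMean_const]
  | insert i s hi ih => simp only [Finset.sum_insert hi, wordMean_add, ih]

open Classical in
/-- The indicator of the words that contain `l` as a (not necessarily contiguous) subword. -/
noncomputable def subwordIndicator (l w : List V) : ℝ := if l.Sublist w then 1 else 0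

/-- A Chernoff bound. When the letters of `l` are matched greedily, each letter of the random word
succeeds with probability `1/|V|`. The number of successes is thus compared with a binomial variable
`N`, and Markov's inequality is applied to `θ^{-N}`. The induction conditions on the first letter of
the random word. -/
lemma wordMean_subwordIndicator_le [Nonempty V] (l : List V) (k : ℕ) {θ : ℝ} (h0 : 0 < θ)
    (h1 : θ ≤ 1) : wordMean k (subwordIndicator l) ≤
      θ ^ l.length * (1 + (θ⁻¹ - 1) * (Fintype.card V : ℝ)⁻¹) ^ k := by
  classical
  have hn : (0 : ℝ) < Fintype.card V := by simp [Fintype.card_pos]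
  have hX : 1 ≤ 1 + (θ⁻¹ - 1) * (Fintype.card V : ℝ)⁻¹ := by
    have := (one_le_inv₀ h0).2 h1
    have : 0 ≤ (θ⁻¹ - 1) * (Fintype.card V : ℝ)⁻¹ := mul_nonneg (by linarith) (by positivity)
    linarith
  induction k generalizing l with
  | zero =>
    cases l with
    | nil => simp [wordMean, subwordIndicator]
    | cons u l =>
      simp only [wordMean, subwordIndicator, List.sublist_nil, reduceCtorEq, if_false]
      positivity
  | succ k ih =>
    cases l with
    | nil =>
      have : subwordIndicator ([] : List V) = fun _ => 1 := by
        funext w; simp [subwordIndicator]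
      rw [this, wordMean_const]
      simpa using one_le_pow₀ hX
    | cons u l =>
      have hstep : ∀ v, wordMean k (fun w => subwordIndicator (u :: l) (v :: w)) ≤
          wordMean k (subwordIndicator (u :: l)) +
            if v = u then wordMean k (subwordIndicator l) -
              wordMean k (subwordIndicator (u :: l)) else 0 := by
        intro v
        split_ifs with h
        · subst h
          rw [add_sub_cancel]
          refine wordMean_mono k fun w => ?_
          simp [subwordIndicator]
        · rw [add_zero]
          refine wordMean_mono k fun w => ?_
          have : (u :: l).Sublist (v :: w) ↔ (u :: l).Sublist w := by
            rw [List.cons_sublist_cons']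
            simp [Ne.symm h]
          simp [subwordIndicator, this]
      have hsum := Finset.sum_le_sum fun v (_ : v ∈ Finset.univ) => hstep v
      rw [Finset.sum_add_distrib, Finset.sum_ite_eq' Finset.univ u] at hsum
      simp only [Finset.sum_const, Finset.card_univ, nsmul_eq_mul, Finset.mem_univ, if_true] at hsum
      have e1 := ih l
      have e2 := ih (u :: l)
      set n : ℝ := ((Fintype.card V : ℕ) : ℝ)
      set X := 1 + (θ⁻¹ - 1) * n⁻¹
      have hn1 : 1 ≤ n := by
        exact Nat.one_le_cast.2 Fintype.card_pos
      have h3 := mul_le_mul_of_nonneg_left e2 (sub_nonneg.2 hn1)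
      rw [wordMean, inv_mul_le_iff₀ hn]
      -- The claimed bound solves the recursion with equality.
      have hfin : n * (θ ^ (u :: l).length * X ^ (k + 1)) =
          (n - 1) * (θ ^ (u :: l).length * X ^ k) + θ ^ l.length * X ^ k := by
        simp only [X, List.length_cons, pow_succ]
        field_simp
        ring
      rw [hfin]
      linarith

/-- The composition of the operators `T v` along a word, the operator of its first letter being
applied first. -/
def wordOp {F : Type*} (T : V → F → F) : List V → F → F
  | [], f => f
  | v :: w, f => wordOp T w (T v f)

end Words

/-! ### Walks as vertex lists, and their number -/

section Chains

variable {V : Type*} (G : SimpleGraph V)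

lemma edist_le_of_isChain (x : V) (l : List V) (h : (x :: l).IsChain G.Adj) :
    G.edist x ((x :: l).getLast (List.cons_ne_nil _ _)) ≤ l.length := by
  induction l generalizing x with
  | nil => simp
  | cons y l ih =>
    rw [List.isChain_cons_cons] at h
    rw [List.getLast_cons_cons]
    refine (SimpleGraph.edist_triangle (v := y)).trans ?_
    refine (add_le_add (SimpleGraph.edist_eq_one_iff_adj.2 h.1).le (ih y h.2)).trans ?_
    simp [add_comm]

variable [Fintype V] [DecidableEq V] [DecidableRel G.Adj]

/-- The initial vertices are dropped until the walk first steps out of `A`; it must do so, since it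
ends in `B`. Starting from `∂ᵢA` puts `|∂ᵢA|` instead of `|A|` into the union bound. -/
lemma exists_chain_from_innerBoundary {A B : Finset V} (hAB : Disjoint A B) (x : V) (l : List V)
    (h : (x :: l).IsChain G.Adj) (hx : x ∈ A)
    (hlast : (x :: l).getLast (List.cons_ne_nil _ _) ∈ B) :
    ∃ y t, (y :: t).Sublist (x :: l) ∧ (y :: t).IsChain G.Adj ∧ y ∈ innerBoundary G A ∧
      (y :: t).getLast (List.cons_ne_nil _ _) ∈ B := by
  induction l generalizing x with
  | nil => exact absurd hlast (Finset.disjoint_left.1 hAB hx)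
  | cons y l ih =>
    by_cases hy : y ∈ A
    · obtain ⟨z, t, h1, h2⟩ := ih y (List.isChain_cons_cons.1 h).2 hy (by simpa using hlast)
      exact ⟨z, t, h1.trans (List.sublist_cons_self _ _), h2⟩
    · exact ⟨x, y :: l, List.Sublist.refl _, h, Finset.mem_filter.2
        ⟨hx, y, hy, (List.isChain_cons_cons.1 h).1⟩, hlast⟩

/-- The vertex sequences of the walks of length `m` that start at `x`. -/
def chainsFrom : ℕ → V → Finset (List V)
  | 0, x => {[x]}
  | m + 1, x => (G.neighborFinset x).biUnion fun y => (chainsFrom m y).image (List.cons x)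

lemma card_chainsFrom_le (m : ℕ) (x : V) : (chainsFrom G m x).card ≤ G.maxDegree ^ m := by
  induction m generalizing x with
  | zero => simp [chainsFrom]
  | succ m ih =>
    rw [pow_succ']
    refine (Finset.card_biUnion_le_card_mul _ _ _ fun y _ => Finset.card_image_le.trans (ih y)).trans
      (Nat.mul_le_mul_right _ ?_)
    rw [SimpleGraph.card_neighborFinset_eq_degree]
    exact G.degree_le_maxDegree x

lemma length_of_mem_chainsFrom {m : ℕ} {x : V} {l : List V} (h : l ∈ chainsFrom G m x) :
    l.length = m + 1 := by
  induction m generalizing x l with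
  | zero => simp_all [chainsFrom]
  | succ m ih =>
    simp only [chainsFrom, Finset.mem_biUnion, Finset.mem_image] at h
    obtain ⟨y, _, t, ht, rfl⟩ := h
    simp [ih ht]

lemma mem_chainsFrom (x : V) (l : List V) (h : (x :: l).IsChain G.Adj) :
    x :: l ∈ chainsFrom G l.length x := by
  induction l generalizing x with
  | nil => simp [chainsFrom]
  | cons y l ih =>
    rw [List.isChain_cons_cons] at h
    simp only [List.length_cons, chainsFrom, Finset.mem_biUnion, Finset.mem_image]
    exact ⟨y, by simpa using h.1, _, ih y h.2, rfl⟩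

/-- The vertex sequences of the walks of length `m` that start in `A`. -/
def chainsFromSet (m : ℕ) (A : Finset V) : Finset (List V) := A.biUnion (chainsFrom G m)

lemma card_chainsFromSet_le (m : ℕ) (A : Finset V) :
    (chainsFromSet G m A).card ≤ A.card * G.maxDegree ^ m :=
  Finset.card_biUnion_le_card_mul _ _ _ fun x _ => card_chainsFrom_le G m x

lemma exists_mem_chainsFromSet {A B : Finset V} {d : ℕ} (hd : (d : ℕ∞) ≤ setDist G A B)
    (hd0 : d ≠ 0) (x : V) (l : List V) (h : (x :: l).IsChain G.Adj) (hx : x ∈ A)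
    (hlast : (x :: l).getLast (List.cons_ne_nil _ _) ∈ B) :
    ∃ t ∈ chainsFromSet G d (innerBoundary G A), t.Sublist (x :: l) := by
  have hdist : ∀ a ∈ A, ∀ b ∈ B, (d : ℕ∞) ≤ G.edist a b := fun a ha b hb =>
    hd.trans ((iInf₂_le a ha).trans (iInf₂_le b hb))
  -- A common vertex would be at distance `0`, which is why `d = 0` is excluded.
  have hAB : Disjoint A B := Finset.disjoint_left.2 fun a ha hb => hd0 <| by
    simpa using hdist a ha a hb
  obtain ⟨y, t, hsub, hchain, hy, hB⟩ := exists_chain_from_innerBoundary G hAB x l h hx hlast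
  have hlen : d ≤ t.length := by
    exact_mod_cast (hdist y (Finset.mem_filter.1 hy).1 _ hB).trans (edist_le_of_isChain G y t hchain)
  have htake : (y :: t.take d).IsChain G.Adj := by
    have := hchain.take (d + 1)
    rwa [List.take_succ_cons] at this
  refine ⟨y :: t.take d, Finset.mem_biUnion.2 ⟨y, hy, ?_⟩, ?_⟩
  · have := mem_chainsFrom G y _ htake
    rwa [List.length_take_of_le hlen] at this
  · exact ((List.take_sublist d t).cons_cons y).trans hsub

end Chains

/-! ### Finite speed of propagation -/

section Comparison

variable {V S : Type*} [Fintype V] [DecidableEq V] [Fintype S]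
variable (P : PairWeights V S) (G : SimpleGraph V) [DecidableRel G.Adj]

/-- The heat-bath operator at `v`, suppressed if `v ∈ B`. -/
noncomputable def heatBathOff (B : Finset V) (v : V) (f : (V → S) → ℝ) : (V → S) → ℝ :=
  if v ∈ B then f else heatBath P G v f

/-- Induction on the word, with `A` the current support. A letter outside `A` does nothing; a letter
`v` in `A` enlarges the support by its neighbours, and a forbidden walk from a new vertex extends
backwards through `v`. Hence no letter in `B` ever acts nontrivially. -/
lemma wordOp_heatBath_eq (A B : Finset V) (w : List V) (f : (V → S) → ℝ)
    (hf : DependsOn f (A : Set V))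
    (hw : ∀ x l, (x :: l).IsChain G.Adj → x ∈ A →
      (x :: l).getLast (List.cons_ne_nil _ _) ∈ B → ¬ (x :: l).Sublist w) :
    wordOp (fun v => heatBath P G v) w f = wordOp (heatBathOff P G B) w f := by
  induction w generalizing A f with
  | nil => rfl
  | cons v w ih =>
    simp only [wordOp]
    by_cases hv : v ∈ A
    · have hvB : v ∉ B := fun hB => hw v [] (by simp) hv (by simpa using hB) (by simp)
      rw [heatBathOff, if_neg hvB]
      refine ih _ _ (dependsOn_heatBath P G hv hf) fun x l hl hx hB hsub => ?_
      rcases Finset.mem_union.1 hx with hx | hx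
      · exact hw x l hl hx hB (hsub.cons v)
      · refine hw v (x :: l) (List.isChain_cons_cons.2 ⟨by simpa using hx, hl⟩) hv ?_
          (hsub.cons_cons v)
        rwa [List.getLast_cons_cons]
    · have h1 : heatBathOff P G B v f = f := by
        unfold heatBathOff
        split_ifs
        · rfl
        · exact heatBath_eq_self P G hv hf
      rw [heatBath_eq_self P G hv hf, h1]
      exact ih A f hf fun x l hl hx hB hsub => hw x l hl hx hB (hsub.cons v)

lemma l2Norm_wordOp_heatBath_le (w : List V) (f : (V → S) → ℝ) :
    l2Norm P G (wordOp (fun v => heatBath P G v) w f) ≤ l2Norm P G f := by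
  induction w generalizing f with
  | nil => exact le_rfl
  | cons v w ih => exact (ih _).trans (l2Norm_heatBath_le P G v f)

lemma gibbsInner_wordOp_heatBathOff {B : Finset V} {g : (V → S) → ℝ}
    (hg : DependsOn g (B : Set V)) (w : List V) (f : (V → S) → ℝ) :
    gibbsInner P G g (wordOp (heatBathOff P G B) w f) = gibbsInner P G g f := by
  induction w generalizing f with
  | nil => rfl
  | cons v w ih =>
    rw [wordOp, ih, heatBathOff]
    split_ifs with hv
    · rfl
    · exact gibbsInner_heatBath_of_notMem P G hv hg f

lemma gibbsInner_meanHeatBath_pow (k : ℕ) (f g : (V → S) → ℝ) :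
    gibbsInner P G g ((meanHeatBath P G ^ k) f) =
      wordMean k fun w => gibbsInner P G g (wordOp (fun v => heatBath P G v) w f) := by
  induction k generalizing f with
  | zero => rfl
  | succ k ih =>
    rw [pow_succ, Module.End.mul_apply, meanHeatBath_apply, map_smul, map_sum,
      gibbsInner_smul_right, gibbsInner_sum_right]
    simp only [ih]
    rfl

lemma gibbsInner_neg_le (f g : (V → S) → ℝ) :
    -gibbsInner P G f g ≤ l2Norm P G f * l2Norm P G g := by
  have h := gibbsInner_le P G f (-g)
  have hn : l2Norm P G (-g) = l2Norm P G g := by simp [l2Norm]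
  rwa [hn, ← neg_one_smul ℝ g, gibbsInner_smul_right, neg_one_mul] at h

/-- Comparison of the stationary covariance with that of the dynamics in discrete time. -/
lemma gibbsInner_le_add [Nonempty V] {A B : Finset V} {d : ℕ} (hd : (d : ℕ∞) ≤ setDist G A B)
    (hd0 : d ≠ 0) {f g : (V → S) → ℝ} (hf : DependsOn f (A : Set V))
    (hg : DependsOn g (B : Set V)) {θ : ℝ} (h0 : 0 < θ) (h1 : θ ≤ 1) (k : ℕ) :
    gibbsInner P G g f ≤ gibbsInner P G g ((meanHeatBath P G ^ k) f) +
      2 * ((innerBoundary G A).card * G.maxDegree ^ d) * θ ^ (d + 1) *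
        (1 + (θ⁻¹ - 1) * (Fintype.card V : ℝ)⁻¹) ^ k * (l2Norm P G f * l2Norm P G g) := by
  classical
  set F := l2Norm P G f * l2Norm P G g
  have hF : 0 ≤ F := mul_nonneg (l2Norm_nonneg P G f) (l2Norm_nonneg P G g)
  set C := chainsFromSet G d (innerBoundary G A)
  have hind : ∀ l w : List V, 0 ≤ subwordIndicator l w := fun l w => by
    unfold subwordIndicator; split_ifs <;> norm_num
  have hword : ∀ w : List V, gibbsInner P G g f ≤
      gibbsInner P G g (wordOp (fun v => heatBath P G v) w f) +
        2 * F * ∑ l ∈ C, subwordIndicator l w := by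
    intro w
    -- A word containing such a walk is charged the trivial Cauchy-Schwarz bound for both
    -- covariances; for any other word they agree.
    by_cases hw : ∃ l ∈ C, l.Sublist w
    · obtain ⟨l, hl, hlw⟩ := hw
      have hone : 1 ≤ ∑ l ∈ C, subwordIndicator l w := by
        refine le_trans ?_ (Finset.single_le_sum (fun l _ => hind l w) hl)
        simp [subwordIndicator, hlw]
      have e1 := gibbsInner_le P G g f
      have e2 := (gibbsInner_neg_le P G g (wordOp (fun v => heatBath P G v) w f)).trans
        (mul_le_mul_of_nonneg_left (l2Norm_wordOp_heatBath_le P G w f) (l2Norm_nonneg P G g))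
      rw [mul_comm] at e1
      have e3 := mul_le_mul_of_nonneg_left hone (mul_nonneg zero_le_two hF)
      rw [mul_comm (l2Norm P G g)] at e2
      linarith
    · have hop := wordOp_heatBath_eq P G A B w f hf fun x l hl hx hB hsub => hw <| by
        obtain ⟨t, ht, hts⟩ := exists_mem_chainsFromSet G hd hd0 x l hl hx hB
        exact ⟨t, ht, hts.trans hsub⟩
      rw [hop, gibbsInner_wordOp_heatBathOff P G hg]
      exact le_add_of_nonneg_right
        (mul_nonneg (mul_nonneg zero_le_two hF) (Finset.sum_nonneg fun l _ => hind l w))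
  have h := wordMean_mono k hword
  rw [wordMean_const, wordMean_add, ← gibbsInner_meanHeatBath_pow, wordMean_const_mul,
    wordMean_sum] at h
  refine h.trans ((add_le_add_iff_left _).2 ?_)
  set X := 1 + (θ⁻¹ - 1) * (Fintype.card V : ℝ)⁻¹
  have hX : 0 ≤ θ ^ (d + 1) * X ^ k := by
    have h2 : 0 ≤ θ⁻¹ - 1 := sub_nonneg.2 ((one_le_inv₀ h0).2 h1)
    have : 0 ≤ X := by positivity
    positivity
  have hsum : ∑ l ∈ C, wordMean k (subwordIndicator l) ≤ C.card * (θ ^ (d + 1) * X ^ k) := by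
    rw [← nsmul_eq_mul]
    refine Finset.sum_le_card_nsmul _ _ _ fun l hl => ?_
    obtain ⟨x, _, hx⟩ := Finset.mem_biUnion.1 hl
    rw [← length_of_mem_chainsFrom G hx]
    exact wordMean_subwordIndicator_le l k h0 h1
  have hcard : (C.card : ℝ) ≤ (innerBoundary G A).card * G.maxDegree ^ d := by
    exact_mod_cast card_chainsFromSet_le G d (innerBoundary G A)
  calc 2 * F * ∑ l ∈ C, wordMean k (subwordIndicator l)
      ≤ 2 * F * (((innerBoundary G A).card * G.maxDegree ^ d) * (θ ^ (d + 1) * X ^ k)) :=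
        mul_le_mul_of_nonneg_left (hsum.trans (mul_le_mul_of_nonneg_right hcard hX)) (by positivity)
    _ = _ := by ring

end Comparison

/-! ### Contraction from the second eigenvalue of a symmetric operator -/

section Spectral

open scoped InnerProductSpace

/-- The second entry of the decreasing list of the roots of the characteristic polynomial. -/
noncomputable def secondEigenvalue {M : Type*} [AddCommGroup M] [Module ℝ M]
    [Module.Finite ℝ M] [Module.Free ℝ M] (T : M →ₗ[ℝ] M) : ℝ :=
  (T.charpoly.roots.sort (· ≥ ·)).getD 1 0

/-- In an eigenbasis, `I + n⁻¹ T` multiplies the coordinates by numbers in `[0, 1]`, and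
orthogonality to the kernel vector `e` removes the top coordinate whenever the second eigenvalue is
not zero. -/
lemma norm_le_of_secondEigenvalue {E : Type*} [NormedAddCommGroup E] [InnerProductSpace ℝ E]
    [FiniteDimensional ℝ E] {T : E →ₗ[ℝ] E} (hT : T.IsSymmetric) {n : ℝ} (hn : 0 < n)
    (hneg : ∀ x, ⟪x, T x⟫_ℝ ≤ 0) (hbd : ∀ x, -(n * ‖x‖ ^ 2) ≤ ⟪x, T x⟫_ℝ) {e : E} (he : e ≠ 0)
    (hTe : T e = 0) {x : E} (hx : ⟪e, x⟫_ℝ = 0) :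
    |secondEigenvalue T| ≤ n ∧ ‖x + n⁻¹ • T x‖ ≤ (1 - |secondEigenvalue T| / n) * ‖x‖ := by
  set N := Module.finrank ℝ E
  have hN : Module.finrank ℝ E = N := rfl
  set ev := hT.eigenvalues hN
  set u := hT.eigenvectorBasis hN
  have hev : ∀ i, ev i = ⟪u i, T (u i)⟫_ℝ := fun i => by
    rw [hT.apply_eigenvectorBasis hN, inner_smul_right, real_inner_self_eq_norm_sq]
    simp [u, ev]
  have hev0 : ∀ i, ev i ≤ 0 := fun i => hev i ▸ hneg _
  have hevn : ∀ i, -n ≤ ev i := fun i => by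
    have := hbd (u i)
    rw [← hev i] at this
    simpa using this
  have hsec : secondEigenvalue T = (List.ofFn ev).getD 1 0 := by
    rw [secondEigenvalue, ← hT.sort_roots_charpoly_eq_eigenvalues hN]
    simp
  have hsec' : secondEigenvalue T ≤ 0 ∧ -n ≤ secondEigenvalue T := by
    rw [hsec]
    by_cases h1 : 1 < N
    · rw [List.getD_eq_getElem _ _ (by simpa using h1)]
      simp [hev0, hevn]
    -- In dimension at most one the default value `0` is read, and the claim is only that the map
    -- does not expand norms.
    · rw [List.getD_eq_default _ _ (by simpa using h1)]
      exact ⟨le_rfl, by linarith⟩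
  rw [abs_of_nonpos hsec'.1]
  have hρ : 0 ≤ 1 - -secondEigenvalue T / n := by
    rw [sub_nonneg, div_le_one hn]; linarith
  have hcoord : ∀ i, u.repr x i = 0 ∨ ev i ≤ secondEigenvalue T := by
    intro i
    by_cases hi : 1 ≤ (i : ℕ)
    · right
      have h1 : 1 < N := lt_of_le_of_lt hi i.2
      rw [hsec, List.getD_eq_getElem _ _ (by simpa using h1), List.getElem_ofFn]
      exact hT.eigenvalues_antitone hN hi
    · rcases hsec'.1.eq_or_lt with h0 | h0
      · right; rw [h0]; exact hev0 i
      -- Every later eigenvalue is now strictly negative, so `e` is a multiple of the top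
      -- eigenvector and `x ⊥ e` has no component along it.
      · left
        have hej : ∀ j, j ≠ i → u.repr e j = 0 := by
          intro j hj
          have hj1 : 1 ≤ (j : ℕ) := by
            by_contra hcon
            exact hj (Fin.ext (by omega))
          have h1 : 1 < N := lt_of_le_of_lt hj1 j.2
          have hle : ev j ≤ secondEigenvalue T := by
            rw [hsec, List.getD_eq_getElem _ _ (by simpa using h1), List.getElem_ofFn]
            exact hT.eigenvalues_antitone hN hj1
          have := hT.eigenvectorBasis_apply_self_apply hN e j
          rw [hTe, map_zero] at this
          have hz : ev j * u.repr e j = 0 := this.symm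
          exact (mul_eq_zero.1 hz).resolve_left (by linarith)
        have hinner : ⟪e, x⟫_ℝ = u.repr e i * u.repr x i := by
          rw [← u.repr.inner_map_map, PiLp.inner_apply, Finset.sum_eq_single i]
          · simp [mul_comm]
          · intro j _ hj; simp [hej j hj]
          · simp
        rw [hinner] at hx
        refine (mul_eq_zero.1 hx).resolve_left fun hz => he ?_
        refine u.repr.injective ?_
        rw [map_zero]
        ext j
        by_cases hj : j = i
        · rw [hj, hz]; rfl
        · rw [hej j hj]; rfl
  refine ⟨by linarith, ?_⟩
  rw [← u.repr.norm_map, ← u.repr.norm_map x, ← Real.sqrt_sq hρ, EuclideanSpace.norm_eq,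
    EuclideanSpace.norm_eq, ← Real.sqrt_mul (sq_nonneg _), Finset.mul_sum]
  refine Real.sqrt_le_sqrt (Finset.sum_le_sum fun i _ => ?_)
  have hrep : u.repr (x + n⁻¹ • T x) i = (1 + ev i / n) * u.repr x i := by
    rw [map_add, map_smul, PiLp.add_apply, PiLp.smul_apply,
      hT.eigenvectorBasis_apply_self_apply hN x i]
    simp only [smul_eq_mul, RCLike.ofReal_real_eq_id, id, u, ev]
    ring
  rw [hrep, Real.norm_eq_abs, Real.norm_eq_abs, sq_abs, sq_abs, mul_pow]
  rcases hcoord i with h | h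
  · simp [h]
  · refine mul_le_mul_of_nonneg_right (pow_le_pow_left₀ ?_ ?_ 2) (sq_nonneg _)
    · have : -1 ≤ ev i / n := by rw [le_div_iff₀ hn]; linarith [hevn i]
      linarith
    · have := div_le_div_of_nonneg_right h hn.le
      rw [neg_div]; linarith

end Spectral

/-! ### The spectral gap and the discrete-time chain -/

section Gap

variable {V S : Type*} [Fintype V] [DecidableEq V] [Fintype S]
variable (P : PairWeights V S) (G : SimpleGraph V) [DecidableRel G.Adj]

noncomputable instance : Fintype (Feasible P G) := Fintype.ofFinite _

lemma gibbsProb_pos (hZ : 0 < partitionFunction P G) (σ : Feasible P G) :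
    0 < gibbsProb P G σ.1 := div_pos σ.2 hZ

/-- Multiplication by `√μ[σ]`, which takes `L²(μ)` isometrically to a Euclidean space. -/
noncomputable def sqrtProbEquiv (hZ : 0 < partitionFunction P G) :
    (Feasible P G → ℝ) ≃ₗ[ℝ] EuclideanSpace ℝ (Feasible P G) :=
  (LinearEquiv.piCongrRight fun σ : Feasible P G => LinearEquiv.smulOfNeZero ℝ ℝ
    (√(gibbsProb P G σ.1)) (Real.sqrt_ne_zero'.2 (gibbsProb_pos P G hZ σ))).trans
    (WithLp.linearEquiv 2 ℝ (Feasible P G → ℝ)).symm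

lemma sqrtProbEquiv_apply (hZ : 0 < partitionFunction P G) (h : Feasible P G → ℝ)
    (σ : Feasible P G) : sqrtProbEquiv P G hZ h σ = √(gibbsProb P G σ.1) * h σ := rfl

open scoped InnerProductSpace

/-- Restriction of functions to the state space. -/
def restrictFeasible (f : (V → S) → ℝ) (σ : Feasible P G) : ℝ := f σ.1

lemma inner_sqrtProbEquiv (hZ : 0 < partitionFunction P G) (f g : (V → S) → ℝ) :
    ⟪sqrtProbEquiv P G hZ (restrictFeasible P G f),
      sqrtProbEquiv P G hZ (restrictFeasible P G g)⟫_ℝ = gibbsInner P G f g := by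
  classical
  rw [PiLp.inner_apply, gibbsInner, gibbsMean]
  have : ∑ σ, gibbsProb P G σ * (f σ * g σ) =
      ∑ σ with 0 < weight P G σ, gibbsProb P G σ * (f σ * g σ) := by
    refine (Finset.sum_filter_of_ne fun σ _ hσ => ?_).symm
    refine lt_of_le_of_ne (weight_nonneg P G σ) fun h => hσ ?_
    simp [gibbsProb, ← h]
  rw [this, Finset.sum_subtype (p := fun σ => 0 < weight P G σ) _ (by simp)]
  refine Finset.sum_congr rfl fun σ _ => ?_
  rw [sqrtProbEquiv_apply, sqrtProbEquiv_apply]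
  simp only [RCLike.inner_apply, conj_trivial, restrictFeasible]
  rw [mul_mul_mul_comm, Real.mul_self_sqrt (gibbsProb_nonneg P G _), mul_comm (g _)]

lemma generator_restrictFeasible (f : (V → S) → ℝ) :
    generator P G (restrictFeasible P G f) =
      restrictFeasible P G (∑ v, (heatBath P G v f - f)) := by
  funext σ
  simp only [restrictFeasible, Finset.sum_apply, Pi.sub_apply]
  refine Finset.sum_congr rfl fun v _ => ?_
  have hZ : localSum P G σ.1 v ≠ 0 := fun h => by
    have := σ.2
    rw [weight_eq_zero_of_localSum P G h] at this
    exact lt_irrefl _ this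
  rw [heatBath_of_ne_zero P G hZ]
  have : f σ.1 = ∑ a : S, heatBathRate P G σ.1 v a * f σ.1 := by
    rw [← Finset.sum_mul, sum_heatBathRate P G hZ, one_mul]
  conv_rhs => rw [this, ← Finset.sum_sub_distrib]
  refine Finset.sum_congr rfl fun a _ => ?_
  rw [← mul_sub]
  by_cases ha : 0 < weight P G (Function.update σ.1 v a)
  · rw [extendZero, dif_pos ha]; rfl
  · rw [heatBathRate_eq_zero P G σ.2 ha, zero_mul, zero_mul]

lemma exists_restrictFeasible (hZ : 0 < partitionFunction P G)
    (x : EuclideanSpace ℝ (Feasible P G)) :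
    ∃ f, sqrtProbEquiv P G hZ (restrictFeasible P G f) = x := by
  refine ⟨extendZero P G ((sqrtProbEquiv P G hZ).symm x), ?_⟩
  rw [← LinearEquiv.eq_symm_apply]
  funext σ
  rw [restrictFeasible, extendZero, dif_pos σ.2]

lemma norm_sqrtProbEquiv (hZ : 0 < partitionFunction P G) (f : (V → S) → ℝ) :
    ‖sqrtProbEquiv P G hZ (restrictFeasible P G f)‖ = l2Norm P G f := by
  rw [l2Norm_eq, ← inner_sqrtProbEquiv P G hZ, real_inner_self_eq_norm_sq,
    Real.sqrt_sq (norm_nonneg _)]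

lemma l2Norm_sq (f : (V → S) → ℝ) : l2Norm P G f ^ 2 = gibbsInner P G f f := by
  rw [l2Norm_eq, Real.sq_sqrt (gibbsInner_self_nonneg P G f)]

/-- The generator, conjugated to a Euclidean space, is `∑_v (E_v - I)`: symmetric, with quadratic
form between `-|V|‖·‖²` and `0`, and annihilating constants. Conjugation keeps the characteristic
polynomial. The bound on the gap makes the contraction factor nonnegative, so that it can be
iterated. -/
lemma l2Norm_meanHeatBath_le [Nonempty V] (hZ : 0 < partitionFunction P G) {f : (V → S) → ℝ}
    (hf : gibbsMean P G f = 0) : spectralGap P G ≤ Fintype.card V ∧ l2Norm P G (meanHeatBath P G f) ≤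
      (1 - spectralGap P G / Fintype.card V) * l2Norm P G f := by
  set J := fun f => sqrtProbEquiv P G hZ (restrictFeasible P G f)
  set T := (sqrtProbEquiv P G hZ).conj (generator P G)
  have hn : (0 : ℝ) < Fintype.card V := by exact_mod_cast Fintype.card_pos (α := V)
  have hTJ : ∀ f, T (J f) = J (∑ v, (heatBath P G v f - f)) := fun f => by
    simp only [T, J, LinearEquiv.conj_apply_apply, LinearEquiv.symm_apply_apply,
      generator_restrictFeasible]
  have hin : ∀ f g, ⟪J f, T (J g)⟫_ℝ =
      ∑ v, (gibbsInner P G f (heatBath P G v g) - gibbsInner P G f g) := fun f g => by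
    rw [hTJ, inner_sqrtProbEquiv, gibbsInner_sum_right]
    simp only [gibbsInner_sub_right]
  have hsymm : T.IsSymmetric := by
    intro x y
    obtain ⟨f, rfl⟩ := exists_restrictFeasible P G hZ x
    obtain ⟨g, rfl⟩ := exists_restrictFeasible P G hZ y
    rw [real_inner_comm]
    change ⟪J g, T (J f)⟫_ℝ = ⟪J f, T (J g)⟫_ℝ
    rw [hin, hin]
    refine Finset.sum_congr rfl fun v _ => ?_
    rw [gibbsInner_heatBath, gibbsInner_comm P G _ f, gibbsInner_comm P G g f]
  have hneg : ∀ x, ⟪x, T x⟫_ℝ ≤ 0 := fun x => by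
    obtain ⟨f, rfl⟩ := exists_restrictFeasible P G hZ x
    refine (hin f f).trans_le (Finset.sum_nonpos fun v _ => ?_)
    linarith [gibbsInner_heatBath_le P G v f]
  have hbd : ∀ x, -(Fintype.card V * ‖x‖ ^ 2) ≤ ⟪x, T x⟫_ℝ := fun x => by
    obtain ⟨f, rfl⟩ := exists_restrictFeasible P G hZ x
    refine le_trans ?_ (hin f f).ge
    rw [norm_sqrtProbEquiv, l2Norm_sq, Finset.sum_sub_distrib, Finset.sum_const, Finset.card_univ,
      nsmul_eq_mul]
    linarith [Finset.sum_nonneg fun v (_ : v ∈ Finset.univ) => gibbsInner_heatBath_nonneg P G v f]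
  have he : J (fun _ => 1) ≠ 0 := by
    rw [← norm_ne_zero_iff, norm_sqrtProbEquiv, l2Norm]
    have : gibbsMean P G (fun _ : V → S => (1 : ℝ) ^ 2) = 1 := by
      simp only [gibbsMean, gibbsProb, one_pow, mul_one, ← Finset.sum_div]
      exact div_self hZ.ne'
    rw [this, Real.sqrt_one]
    exact one_ne_zero
  have hTe : T (J fun _ => 1) = 0 := by
    rw [hTJ]
    simp only [heatBath_one, sub_self, Finset.sum_const_zero]
    exact map_zero (sqrtProbEquiv P G hZ)
  have hx : ⟪J fun _ => 1, J f⟫_ℝ = 0 := by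
    rw [inner_sqrtProbEquiv, ← gibbsMean_eq_inner, hf]
  have h := norm_le_of_secondEigenvalue hsymm hn hneg hbd he hTe hx
  have hgap : spectralGap P G = |secondEigenvalue T| := by
    rw [secondEigenvalue, LinearEquiv.charpoly_conj]
    rfl
  have hJ : J f + (Fintype.card V : ℝ)⁻¹ • T (J f) = J (meanHeatBath P G f) := by
    rw [hTJ]
    simp only [J]
    rw [← map_smul, ← map_add]
    congr 1
    funext σ
    simp only [Pi.add_apply, Pi.smul_apply, restrictFeasible, meanHeatBath_apply,
      Finset.sum_apply, Pi.sub_apply, Finset.sum_sub_distrib, Finset.sum_const, Finset.card_univ,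
      nsmul_eq_mul, smul_eq_mul]
    rw [mul_sub, Pi.mul_apply, Pi.natCast_apply, inv_mul_cancel_left₀ hn.ne', add_sub_cancel]
  rwa [hJ, ← hgap, norm_sqrtProbEquiv, norm_sqrtProbEquiv] at h

lemma l2Norm_meanHeatBath_pow_le [Nonempty V] (hZ : 0 < partitionFunction P G)
    {f : (V → S) → ℝ} (hf : gibbsMean P G f = 0) (k : ℕ) :
    l2Norm P G ((meanHeatBath P G ^ k) f) ≤
      (1 - spectralGap P G / Fintype.card V) ^ k * l2Norm P G f := by
  have hn : (0 : ℝ) < Fintype.card V := by exact_mod_cast Fintype.card_pos (α := V)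
  induction k generalizing f with
  | zero => simp
  | succ k ih =>
    rw [pow_succ, Module.End.mul_apply, pow_succ, mul_assoc]
    refine (ih (by rw [gibbsMean_meanHeatBath, hf])).trans ?_
    exact mul_le_mul_of_nonneg_left (l2Norm_meanHeatBath_le P G hZ hf).2
      (pow_nonneg (sub_nonneg.2 ((div_le_one hn).2 (l2Norm_meanHeatBath_le P G hZ hf).1)) k)

end Gap

/-! ### Poisson averaging and the rate function -/

/-- Average the hypothesis over `k` with the Poisson weights `e^{-s} s^k / k!`. -/
lemma le_exp_of_forall_le_pow {x u a w b s : ℝ} (hs : 0 ≤ s)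
    (h : ∀ k : ℕ, x ≤ u * a ^ k + w * b ^ k) :
    x ≤ u * Real.exp (s * (a - 1)) + w * Real.exp (s * (b - 1)) := by
  have hexp : ∀ y : ℝ, HasSum (fun k : ℕ => y ^ k / k.factorial) (Real.exp y) := fun y => by
    rw [Real.exp_eq_exp_ℝ]
    exact NormedSpace.expSeries_div_hasSum_exp y
  have hle := hasSum_le (fun k => ?_) ((hexp s).mul_left x)
    (((hexp (s * a)).mul_left u).add ((hexp (s * b)).mul_left w))
  · rw [mul_sub, mul_sub, mul_one, Real.exp_sub, Real.exp_sub, ← mul_div_assoc, ← mul_div_assoc,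
      ← add_div, le_div_iff₀ (Real.exp_pos s)]
    exact hle
  · have := mul_le_mul_of_nonneg_right (h k) (show 0 ≤ s ^ k / k.factorial by positivity)
    refine this.trans_eq ?_
    rw [mul_pow, mul_pow]
    ring

lemma rateI_lt_rateI {x y : ℝ} (hx : 0 < x) (hxy : x < y) (hy : y ≤ 1) : rateI y < rateI x := by
  have hy0 := hx.trans hxy
  have h := Real.log_lt_sub_one_of_pos (div_pos hx hy0) (div_lt_one hy0 |>.2 hxy).ne
  rw [Real.log_div hx.ne' hy0.ne'] at h
  have h2 : y - x ≤ (y - x) / y := by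
    rw [le_div_iff₀ hy0]; nlinarith
  rw [sub_div, div_self hy0.ne'] at h2
  unfold rateI
  linarith

lemma existsUnique_isCritical {Δ : ℕ} (hΔ : 1 ≤ Δ) : ∃! c : ℝ, IsCritical Δ c := by
  -- The left endpoint `b` below is chosen so that `I(b) = log Δ + b`, while `I(1) = 0`.
  have hΔ' : (1 : ℝ) ≤ Δ := by exact_mod_cast hΔ
  have hlog : 0 ≤ Real.log Δ := Real.log_nonneg hΔ'
  set b := Real.exp (-(1 + Real.log Δ))
  have hb : 0 < b := Real.exp_pos _
  have hb1 : b ≤ 1 := Real.exp_le_one_iff.2 (by linarith)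
  have hcont : ContinuousOn rateI (Set.Icc b 1) :=
    (continuousOn_id.sub (Real.continuousOn_log.mono fun x hx => (hb.trans_le hx.1).ne')).sub
      continuousOn_const
  have hmem : Real.log Δ ∈ Set.Icc (rateI 1) (rateI b) := by
    refine ⟨by simpa [rateI] using hlog, ?_⟩
    simp only [rateI, b, Real.log_exp]
    linarith
  obtain ⟨c, hc, hcI⟩ := intermediate_value_Icc' hb1 hcont hmem
  refine ⟨c, ⟨hb.trans_le hc.1, hc.2, hcI⟩, fun c' ⟨h0, h1, h2⟩ => ?_⟩
  rcases lt_trichotomy c' c with h | h | h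
  · exact absurd (rateI_lt_rateI h0 h hc.2) (by rw [hcI, h2]; exact lt_irrefl _)
  · exact h
  · exact absurd (rateI_lt_rateI (hb.trans_le hc.1) h h1) (by rw [hcI, h2]; exact lt_irrefl _)

lemma one_le_constC {Δ : ℕ} {cs c : ℝ} (hcs : IsCritical Δ cs) (h0 : 0 < c) (hc : c < cs) :
    1 ≤ constC c Δ := by
  have hI := rateI_lt_rateI h0 hc hcs.2.1
  rw [hcs.2.2] at hI
  have h1 : Real.exp (Real.log Δ - rateI c) < 1 := Real.exp_lt_one_iff.2 (by linarith)
  exact Real.one_le_rpow_of_pos_of_le_one_of_nonpos (by linarith)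
    (by linarith [Real.exp_pos (Real.log Δ - rateI c)]) (by norm_num)

/-! ### The covariance bound -/

section Covariance

variable {V S : Type*} [Fintype V] [DecidableEq V] [Fintype S]
variable (P : PairWeights V S) (G : SimpleGraph V) [DecidableRel G.Adj]

lemma gibbsMean_mul_le [Nonempty V] (hZ : 0 < partitionFunction P G) (hΔ : 1 ≤ G.maxDegree)
    {A B : Finset V} {d : ℕ} (hd : (d : ℕ∞) ≤ setDist G A B) {f g : (V → S) → ℝ}
    (hf : DependsOn f (A : Set V)) (hg : DependsOn g (B : Set V)) (hf0 : gibbsMean P G f = 0)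
    {c : ℝ} (h0 : 0 < c) (h1 : c ≤ 1) :
    gibbsMean P G (fun σ => f σ * g σ) ≤
      (Real.exp (-(c * d * spectralGap P G)) +
        2 * √((innerBoundary G A).card * Real.exp (d * (Real.log G.maxDegree - rateI c)))) *
      (l2Norm P G f * l2Norm P G g) := by
  set F := l2Norm P G f * l2Norm P G g
  have hF : 0 ≤ F := mul_nonneg (l2Norm_nonneg P G f) (l2Norm_nonneg P G g)
  set q := (innerBoundary G A).card * Real.exp (d * (Real.log G.maxDegree - rateI c)) with hq
  have hq0 : 0 ≤ q := by positivity
  change gibbsInner P G f g ≤ _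
  have hCS : gibbsInner P G f g ≤ 1 * F := by
    rw [one_mul]; exact gibbsInner_le P G f g
  rcases Nat.eq_zero_or_pos d with rfl | hdpos
  · refine hCS.trans (mul_le_mul_of_nonneg_right ?_ hF)
    simp only [Nat.cast_zero, mul_zero, zero_mul, neg_zero, Real.exp_zero]
    exact le_add_of_nonneg_right (by positivity)
  -- For `q ≥ 1` the square-root term alone exceeds the Cauchy-Schwarz constant `1`.
  rcases le_total 1 q with hq1 | hq1
  · refine hCS.trans (mul_le_mul_of_nonneg_right ?_ hF)
    have := Real.one_le_sqrt.2 hq1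
    have := Real.exp_pos (-(c * d * spectralGap P G))
    linarith
  have hn : (0 : ℝ) < Fintype.card V := by exact_mod_cast Fintype.card_pos (α := V)
  have hk := fun k => (gibbsInner_le_add P G hd hdpos.ne' hf hg h0 h1 k).trans
    (add_le_add_left ((gibbsInner_le P G g _).trans (mul_le_mul_of_nonneg_left
      (l2Norm_meanHeatBath_pow_le P G hZ hf0 k) (l2Norm_nonneg P G g))) _)
  -- The Poisson parameter `c d |V|` corresponds to continuous time `cd`; with `θ = c` the Chernoff
  -- factor becomes `e^{d(1 - c)}`.
  have hsum := le_exp_of_forall_le_pow (x := gibbsInner P G g f) (u := F)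
    (a := 1 - spectralGap P G / Fintype.card V)
    (w := 2 * ((innerBoundary G A).card * G.maxDegree ^ d) * c ^ (d + 1) * F)
    (b := 1 + (c⁻¹ - 1) * (Fintype.card V : ℝ)⁻¹)
    (s := c * d * Fintype.card V) (by positivity)
    fun k => (hk k).trans_eq (by simp only [F]; ring)
  rw [gibbsInner_comm]
  refine hsum.trans ?_
  have e1 : c * d * Fintype.card V * (1 - spectralGap P G / Fintype.card V - 1) =
      -(c * d * spectralGap P G) := by field_simp; ring
  have e2 : c * d * Fintype.card V * (1 + (c⁻¹ - 1) * (Fintype.card V : ℝ)⁻¹ - 1) =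
      d * (1 - c) := by field_simp; ring
  have hΔ0 : (0 : ℝ) < G.maxDegree := by exact_mod_cast hΔ
  have e3 : Real.exp (d * (Real.log G.maxDegree - rateI c)) =
      G.maxDegree ^ d * c ^ d * Real.exp (d * (1 - c)) := by
    have : d * (Real.log G.maxDegree - rateI c) =
        d * Real.log G.maxDegree + d * Real.log c + d * (1 - c) := by
      unfold rateI; ring
    rw [this, Real.exp_add, Real.exp_add, Real.exp_nat_mul, Real.exp_nat_mul, Real.exp_log hΔ0,
      Real.exp_log h0]
  have e4 : 2 * ((innerBoundary G A).card * G.maxDegree ^ d : ℝ) * c ^ (d + 1) * F *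
      Real.exp (d * (1 - c)) = 2 * (c * q) * F := by
    rw [hq, e3]; ring
  rw [e1, e2, e4, mul_comm F, ← add_mul]
  refine mul_le_mul_of_nonneg_right ?_ hF
  -- The walks have `d + 1` vertices, which leaves a spare factor `c`.
  have h2 : c * q ≤ q := mul_le_of_le_one_left hq0 h1
  have h3 : q ≤ √q := Real.le_sqrt_of_sq_le (by nlinarith)
  linarith

end Covariance

end Glauber

theorem mainTheorem6 {V S : Type*} [Fintype V] [DecidableEq V] [Fintype S]
    (G : SimpleGraph V) [DecidableRel G.Adj] (P : Glauber.PairWeights V S)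
    (hZ : 0 < Glauber.partitionFunction P G) (hΔ : 1 ≤ G.maxDegree) :
    (∃! cs : ℝ, Glauber.IsCritical G.maxDegree cs) ∧
    ∀ (A B : Finset V) (d : ℕ), (d : ℕ∞) ≤ Glauber.setDist G A B →
      ∀ f g : (V → S) → ℝ, DependsOn f (A : Set V) → DependsOn g (B : Set V) →
        Glauber.gibbsMean P G f = 0 → Glauber.gibbsMean P G g = 0 →
        (∀ cs : ℝ, Glauber.IsCritical G.maxDegree cs → ∀ c : ℝ, 0 < c → c < cs →
          Glauber.gibbsMean P G (fun σ => f σ * g σ) ≤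
            (Real.exp (-(c * d * Glauber.spectralGap P G)) +
              2 * Glauber.constC c G.maxDegree *
                Real.sqrt ((Glauber.innerBoundary G A).card *
                  Real.exp (d * (Real.log G.maxDegree - Glauber.rateI c)))) *
            Glauber.l2Norm P G f * Glauber.l2Norm P G g) ∧
        (∀ γ : ℝ, 0 ≤ γ →
          Glauber.gibbsMean P G (fun σ => f σ * g σ) ≤
            (Real.exp (-(d * Glauber.spectralGap P G *
                Real.exp (-Real.log G.maxDegree - γ - 2))) +
              4 * Real.sqrt (Real.exp (-((γ + 1) * d)) * (Glauber.innerBoundary G A).card)) *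
            Glauber.l2Norm P G f * Glauber.l2Norm P G g) := by
  have hV : Nonempty V := by
    by_contra h
    rw [not_nonempty_iff] at h
    simp at hΔ
  refine ⟨Glauber.existsUnique_isCritical hΔ, fun A B d hd f g hf hg hf0 _ => ⟨?_, ?_⟩⟩
  · intro cs hcs c h0 hc
    have hC := Glauber.one_le_constC hcs h0 hc
    refine (Glauber.gibbsMean_mul_le P G hZ hΔ hd hf hg hf0 h0 (hc.le.trans hcs.2.1)).trans ?_
    rw [mul_assoc _ (Glauber.l2Norm P G f)]
    refine mul_le_mul_of_nonneg_right ((add_le_add_iff_left _).2 ?_)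
      (mul_nonneg (Glauber.l2Norm_nonneg P G f) (Glauber.l2Norm_nonneg P G g))
    exact mul_le_mul_of_nonneg_right (by linarith) (Real.sqrt_nonneg _)
  · intro γ hγ
    have hlog : 0 ≤ Real.log G.maxDegree := Real.log_natCast_nonneg _
    -- With this `c`, `log Δ - I(c) = -(γ + 1) - c`.
    set c := Real.exp (-Real.log G.maxDegree - γ - 2) with hc
    have h0 : 0 < c := Real.exp_pos _
    have h1 : c ≤ 1 := Real.exp_le_one_iff.2 (by linarith)
    refine (Glauber.gibbsMean_mul_le P G hZ hΔ hd hf hg hf0 h0 h1).trans ?_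
    rw [mul_assoc _ (Glauber.l2Norm P G f)]
    refine mul_le_mul_of_nonneg_right (add_le_add (Real.exp_le_exp.2 (by linarith)) ?_)
      (mul_nonneg (Glauber.l2Norm_nonneg P G f) (Glauber.l2Norm_nonneg P G g))
    refine mul_le_mul (by norm_num) (Real.sqrt_le_sqrt ?_) (Real.sqrt_nonneg _) (by norm_num)
    rw [mul_comm]
    refine mul_le_mul_of_nonneg_right (Real.exp_le_exp.2 ?_) (Nat.cast_nonneg _)
    have hI : Real.log G.maxDegree - Glauber.rateI c ≤ -(γ + 1) := by
      rw [Glauber.rateI, hc, Real.log_exp, ← hc]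
      linarith
    have := mul_le_mul_of_nonneg_left hI (Nat.cast_nonneg (α := ℝ) d)
    linarith
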